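/- Let $k$ be a field of characteristic $0$, let $\alpha,\beta,\gamma\in k$ with $\beta\neq 0$ and $\gamma\neq 0$, and suppose that $k$ contains the roots $\lambda,\mu$ (with multiplicity) of the polynomial $t^2-\alpha t-\beta$, i.e. $t^2-\alpha t-\beta=(t-\lambda)(t-\mu)$. Let $A=A(\alpha,\beta,\gamma)$ be the down-up algebra, i.e. the associative unital $k$-algebra generated by $u,d$ subject to $du^2=\alpha udu+\beta u^2d+\gamma u$ and $d^2u=\alpha dud+\beta ud^2+\gamma d$. Put $$\omega=\gamma^{-1}(du-\lambda ud),\qquad a=(\omega+\mu^{-1})(1+u)-\mu^{-1},\qquad b=\omega^2+\mu^{-1}\omega .$$ Then the right ideal $aA+bA$ of $A$ is finitely generated and stably free, but not free. Moreover, let $\widetilde A$ be the subalgebra of $A$ generated by $u$ and $\omega$. Then: (i) $\widetilde A$ is the Ore extension $k[u][\omega;\sigma,\delta]$, with the convention $p\,\omega=\omega\,\sigma(p)+\delta(p)$ and $\delta(pq)=\delta(p)\sigma(q)+p\,\delta(q)$ for $p,q\in k[u]$ (so every element of $\widetilde A$ is a unique finite sum $\sum_n\omega^n p_n$ with $p_n\in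 k[u]$, and $k[u]$ is a polynomial ring), where $\sigma$ is a $k$-algebra automorphism of $k[u]$ with $\sigma(u)=\mu^{-1}u$ and $\delta$ is a $k$-linear $\sigma$-derivation of $k[u]$ with $\delta(u)=-\mu^{-1}u$; (ii) $A$ is free as a left $\widetilde A$-module, with basis $\{d^n\mid n\geq 0\}$; (iii) the right ideal $K=\{f\in\widetilde A\mid (1+u)f\in\omega\widetilde A\}$ of $\widetilde A$ is finitely generated and stably free, but not free, and $K=a\widetilde A+b\widetilde A$; (iv) the right ideal $KA$ of $A$ generated by $K$ equals $aA+bA$. -/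

import Mathlib

open Polynomial

/-! ### Right ideals of a ring -/

/-- Right ideals of `S`: the submodules of `S` viewed as a right module over itself. -/
abbrev RightIdeal (S : Type*) [Ring S] : Type _ := Submodule Sᵐᵒᵖ S

/-- The right ideal `aS + bS`. -/
def rightIdealPair {S : Type*} [Ring S] (a b : S) : RightIdeal S :=
  Submodule.span Sᵐᵒᵖ {a, b}

/-- The right ideal `{f ∈ S | r f ∈ w S}`. -/
def rightColon {S : Type*} [Ring S] (r w : S) : RightIdeal S where
  carrier := {f | ∃ g : S, r * f = w * g}
  zero_mem' := ⟨0, by simp⟩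
  add_mem' := by
    rintro f f' ⟨g, hg⟩ ⟨g', hg'⟩
    exact ⟨g + g', by rw [mul_add, mul_add, hg, hg']⟩
  smul_mem' := by
    rintro c f ⟨g, hg⟩
    refine ⟨g * c.unop, ?_⟩
    change r * (f * c.unop) = _
    rw [← mul_assoc, hg, mul_assoc]

/-- A right ideal is a non-trivial stably free right ideal if, as a right module, it is
finitely generated and stably free but not free. -/
def IsNontrivialStablyFree {S : Type*} [Ring S] (I : RightIdeal S) : Prop :=
  Module.Finite Sᵐᵒᵖ I ∧ Module.IsStablyFree Sᵐᵒᵖ I ∧ ¬ Module.Free Sᵐᵒᵖ I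

/-! ### Ore extensions -/

/-- `S`, together with `ι : R → S` and `x : S`, is the Ore extension `R[x; σ, δ]`, in the convention
with the coefficients on the right: `δ` is a `σ`-derivation, `r x = x σ(r) + δ(r)` for
`r ∈ R`, and every element of `S` is a unique finite sum `∑ xⁿ rₙ` with `rₙ ∈ R`. -/
structure IsOreExtension {R S : Type*} [Ring R] [Ring S] (ι : R →+* S) (x : S)
    (σ : R ≃+* R) (δ : R →+ R) : Prop where
  leibniz : ∀ p q : R, δ (p * q) = δ p * σ q + p * δ q
  comm : ∀ p : R, ι p * x = x * ι (σ p) + ι (δ p)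
  existsUnique_sum : ∀ s : S, ∃! c : ℕ →₀ R, s = c.sum fun n p => x ^ n * ι p

/-! ### Down-up algebras -/

/-- The two generators of a down-up algebra. -/
inductive DownUpGen : Type
  | u
  | d

/-- The defining relations `d u² = α u d u + β u² d + γ u` and `d² u = α d u d + β u d² + γ d`. -/
inductive DownUpRel (k : Type*) [Field k] (α β γ : k) :
    FreeAlgebra k DownUpGen → FreeAlgebra k DownUpGen → Prop
  | up : DownUpRel k α β γ
      (FreeAlgebra.ι k DownUpGen.d * FreeAlgebra.ι k DownUpGen.u ^ 2)
      (α • (FreeAlgebra.ι k DownUpGen.u * FreeAlgebra.ι k DownUpGen.d *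
          FreeAlgebra.ι k DownUpGen.u) +
        β • (FreeAlgebra.ι k DownUpGen.u ^ 2 * FreeAlgebra.ι k DownUpGen.d) +
        γ • FreeAlgebra.ι k DownUpGen.u)
  | down : DownUpRel k α β γ
      (FreeAlgebra.ι k DownUpGen.d ^ 2 * FreeAlgebra.ι k DownUpGen.u)
      (α • (FreeAlgebra.ι k DownUpGen.d * FreeAlgebra.ι k DownUpGen.u *
          FreeAlgebra.ι k DownUpGen.d) +
        β • (FreeAlgebra.ι k DownUpGen.u * FreeAlgebra.ι k DownUpGen.d ^ 2) +
        γ • FreeAlgebra.ι k DownUpGen.d)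

/-- The down-up algebra `A(α, β, γ)` over `k`. -/
abbrev DownUpAlgebra (k : Type*) [Field k] (α β γ : k) : Type _ :=
  RingQuot (DownUpRel k α β γ)

namespace DownUpAlgebra

variable {k : Type*} [Field k] (α β γ : k)

/-- The generator `u` of `A(α, β, γ)`. -/
def u : DownUpAlgebra k α β γ :=
  RingQuot.mkAlgHom k (DownUpRel k α β γ) (FreeAlgebra.ι k DownUpGen.u)

/-- The generator `d` of `A(α, β, γ)`. -/
def d : DownUpAlgebra k α β γ :=
  RingQuot.mkAlgHom k (DownUpRel k α β γ) (FreeAlgebra.ι k DownUpGen.d)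

/-- The element `ω = γ⁻¹ (d u - lam u d)`. -/
def omega (lam : k) : DownUpAlgebra k α β γ :=
  γ⁻¹ • (d α β γ * u α β γ - lam • (u α β γ * d α β γ))

/-- The subalgebra `Ã` of `A(α, β, γ)` generated by `u` and `ω`. -/
def tilde (lam : k) : Subalgebra k (DownUpAlgebra k α β γ) :=
  Algebra.adjoin k {u α β γ, omega α β γ lam}

/-- `u` as an element of `Ã`. -/
def uTilde (lam : k) : tilde α β γ lam :=
  ⟨u α β γ, Algebra.subset_adjoin (by simp)⟩

/-- `ω` as an element of `Ã`. -/
def omegaTilde (lam : k) : tilde α β γ lam :=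
  ⟨omega α β γ lam, Algebra.subset_adjoin (by simp)⟩

/-- The right ideal `K = {f ∈ Ã | (1 + u) f ∈ ω Ã}` of `Ã`. -/
def idealK (lam : k) : RightIdeal (tilde α β γ lam) :=
  rightColon (1 + uTilde α β γ lam) (omegaTilde α β γ lam)

/-- The right ideal `KA` of `A` generated by `K`. -/
def idealKA (lam : k) : RightIdeal (DownUpAlgebra k α β γ) :=
  Submodule.span (DownUpAlgebra k α β γ)ᵐᵒᵖ
    ((fun f : tilde α β γ lam => (f : DownUpAlgebra k α β γ)) '' idealK α β γ lam)

/-- The expression `a = (w + mu⁻¹) (1 + v) - mu⁻¹` in a `k`-algebra. -/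
def genA {S : Type*} [Ring S] [Algebra k S] (mu : k) (v w : S) : S :=
  (w + algebraMap k S mu⁻¹) * (1 + v) - algebraMap k S mu⁻¹

/-- The expression `b = w² + mu⁻¹ w` in a `k`-algebra. -/
def genB {S : Type*} [Ring S] [Algebra k S] (mu : k) (w : S) : S :=
  w ^ 2 + mu⁻¹ • w

end DownUpAlgebra

/-! The relation `ω u = u (μ ω + 1)` gives `(1 + u)(μ ω + 1) - ω (u + μ) = 1`, so over `S = Ã` and
over `S = A` the map `S² → S`, `(x, y) ↦ (1 + u) x - ω y`, is a split surjection. Since `ω` is left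
regular, its kernel is the colon ideal of `1 + u` and `ω` through the first coordinate. Thus `S²` is
this ideal plus `S`, and projecting the standard basis of `S²` to the kernel yields `a` and `b` up
to scalars (`rightColon_eq_rightIdealPair`, `exists_rightColon_prod_equiv`).

The augmentation `u, d ↦ 0` gives `S` invariant basis number, so a free kernel would have rank one
and be principal, say `cS`. This is excluded over `A` in `rightIdealPair_ne_span_singleton`, by
degrees in the tower `k[ω] ⊂ Ã ⊂ A` of Ore extensions in `u` and then `d`. As `c` divides `b ∈
k[ω]`, it lies in `k[ω]`; as it divides `a = ω + (ω + μ⁻¹) u`, it divides `ω` and `ω + μ⁻¹`, so it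
is a unit. But `1` is not in the ideal, because `1 + u ∉ ωA`. A principal `K` would make `KA`
principal, so `Ã` follows from `A`.

The tower rests on the independence of the monomials `ωⁱ uʲ dˡ`, which is read off from a
representation on two-sided sequences. -/

/-! ### Invariant basis number, colon ideals and stable freeness -/

/-- The matrices of an isomorphism and of its inverse map to mutually inverse matrices over a
commutative ring, which must be square. -/
theorem invariantBasisNumber_of_ringHom {R S : Type*} [Ring R] [CommRing S] [Nontrivial S]
    (f : R →+* S) : InvariantBasisNumber R := by
  refine ⟨fun {n m} e => ?_⟩
  have key : ∀ {n m : ℕ} (e : (Fin n → R) ≃ₗ[R] (Fin m → R)),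
      (Matrix.of fun i j => f (e (Pi.single i 1) j)) *
        (Matrix.of fun j i => f (e.symm (Pi.single j 1) i)) = 1 := by
    intro n m e
    ext i i'
    have h : e.symm (e (Pi.single i 1)) i' =
        ∑ j, e (Pi.single i 1) j * e.symm (Pi.single j 1) i' := by
      conv_lhs => rw [pi_eq_sum_univ' (e (Pi.single i 1))]
      simp [map_sum, Finset.sum_apply]
    rw [LinearEquiv.symm_apply_apply] at h
    simp only [Matrix.mul_apply, Matrix.of_apply, ← map_mul, ← map_sum, ← h]
    simp [Pi.single_apply, Matrix.one_apply, eq_comm]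
  simpa using Matrix.square_of_invertible _ _ (key e) (key e.symm)

theorem mem_rightIdealPair {S : Type*} [Ring S] {a b x : S} :
    x ∈ rightIdealPair a b ↔ ∃ s t, x = a * s + b * t := by
  rw [rightIdealPair, Submodule.mem_span_pair]
  constructor
  · rintro ⟨s, t, h⟩
    exact ⟨s.unop, t.unop, h.symm⟩
  · rintro ⟨s, t, h⟩
    exact ⟨.op s, .op t, h.symm⟩

theorem mem_rightColon {S : Type*} [Ring S] {r w x : S} :
    x ∈ rightColon r w ↔ ∃ g, r * x = w * g := Iff.rfl

section RightColon

variable {S : Type*} [Ring S] {r w p q : S}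

/-- The projection of `S²` onto the kernel of `(x, y) ↦ r x - w y` along `s ↦ (p s, q s)` sends the
standard basis to vectors with first coordinates `1 - p r` and `p w`. -/
theorem rightColon_eq_rightIdealPair (h : r * p - w * q = 1) :
    rightColon r w = rightIdealPair (1 - p * r) (p * w) := by
  have h' : r * p = 1 + w * q := by rw [← h]; abel
  ext x
  rw [mem_rightIdealPair, mem_rightColon]
  constructor
  · rintro ⟨g, hg⟩
    refine ⟨x, g, ?_⟩
    rw [mul_assoc, ← hg]
    noncomm_ring
  · rintro ⟨s, t, rfl⟩
    refine ⟨-(q * r * s) + t + q * w * t, ?_⟩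
    have : r * ((1 - p * r) * s + p * w * t) = r * s - r * p * r * s + r * p * w * t := by
      noncomm_ring
    rw [this, h']
    noncomm_ring

/-- The splitting of the surjection `S² → S`, `(x, y) ↦ r x - w y`. -/
theorem exists_rightColon_prod_equiv (h : r * p - w * q = 1) (hw : ∀ g, w * g = 0 → g = 0) :
    Nonempty ((S × S) ≃ₗ[Sᵐᵒᵖ] (rightColon r w × S)) := by
  have h' : r * p = 1 + w * q := by rw [← h]; abel
  -- The first component is the projection to the kernel along the section `s ↦ (p s, q s)`. Only
  -- its first coordinate is kept; `hw` recovers the second.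
  let F : (S × S) →ₗ[Sᵐᵒᵖ] (rightColon r w × S) :=
    { toFun := fun z => (⟨z.1 - p * (r * z.1 - w * z.2), z.2 - q * (r * z.1 - w * z.2), by
        rw [mul_sub, ← mul_assoc r p, h']; noncomm_ring⟩, r * z.1 - w * z.2)
      map_add' := fun z z' => by
        ext <;> simp <;> noncomm_ring
      map_smul' := fun c z => by
        ext
        · change z.1 * c.unop - p * (r * (z.1 * c.unop) - w * (z.2 * c.unop)) =
            (z.1 - p * (r * z.1 - w * z.2)) * c.unop
          noncomm_ring
        · change r * (z.1 * c.unop) - w * (z.2 * c.unop) = (r * z.1 - w * z.2) * c.unop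
          noncomm_ring }
  refine ⟨LinearEquiv.ofBijective F ⟨?_, ?_⟩⟩
  · rw [injective_iff_map_eq_zero]
    rintro ⟨x, y⟩ hz
    have h2 : r * x - w * y = 0 := congrArg Prod.snd hz
    have h1 : x - p * (r * x - w * y) = 0 :=
      congrArg (fun t : rightColon r w × S => (t.1 : S)) hz
    rw [h2, mul_zero, sub_zero] at h1
    subst h1
    rw [mul_zero, zero_sub, neg_eq_zero] at h2
    rw [hw y h2]
    rfl
  · rintro ⟨⟨f, g, hg⟩, s⟩
    have hs : r * (f + p * s) - w * (g + q * s) = s := by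
      rw [mul_add, mul_add, hg, ← mul_assoc, h']
      noncomm_ring
    refine ⟨(f + p * s, g + q * s), ?_⟩
    ext
    · change f + p * s - p * (r * (f + p * s) - w * (g + q * s)) = f
      rw [hs]
      abel
    · exact hs

end RightColon

/-- A ring is free of rank one as a right module over itself. -/
noncomputable def rightRegularBasis (S : Type*) [Ring S] : Module.Basis Unit Sᵐᵒᵖ S :=
  (Module.Basis.singleton Unit Sᵐᵒᵖ).map
    { toFun := MulOpposite.unop
      invFun := MulOpposite.op
      left_inv := fun _ => rfl
      right_inv := fun _ => rfl
      map_add' := fun _ _ => rfl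
      map_smul' := fun _ _ => rfl }

theorem finite_and_isStablyFree_of_prod_equiv {S : Type*} [Ring S] {I : RightIdeal S}
    (e : (S × S) ≃ₗ[Sᵐᵒᵖ] (I × S)) :
    Module.Finite Sᵐᵒᵖ I ∧ Module.IsStablyFree Sᵐᵒᵖ I := by
  have hf : Module.Free Sᵐᵒᵖ S := .of_basis (rightRegularBasis S)
  have hfin : Module.Finite Sᵐᵒᵖ S := .of_basis (rightRegularBasis S)
  have : Module.Free Sᵐᵒᵖ (I × S) := .of_equiv e
  refine ⟨?_, .of_free_prod Sᵐᵒᵖ I S⟩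
  exact .of_surjective (LinearMap.fst Sᵐᵒᵖ I S ∘ₗ e.toLinearMap)
    (Prod.fst_surjective.comp e.surjective)

/-- A free right ideal of rank one is principal. -/
theorem exists_eq_span_singleton_of_free {S : Type*} [Ring S] [InvariantBasisNumber Sᵐᵒᵖ]
    {I : RightIdeal S} (e : (S × S) ≃ₗ[Sᵐᵒᵖ] (I × S)) (h : Module.Free Sᵐᵒᵖ I) :
    ∃ c : S, I = Submodule.span Sᵐᵒᵖ {c} := by
  obtain ⟨ι, b⟩ := h.exists_basis
  -- Two bases of `I × S`, indexed by `ι ⊕ Unit` and `Unit ⊕ Unit`, are equinumerous, so `ι` is a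
  -- singleton.
  have i := (b.prod (rightRegularBasis S)).indexEquiv
    (((rightRegularBasis S).prod (rightRegularBasis S)).map e)
  have : Finite (ι ⊕ Unit) := .of_equiv _ i.symm
  have : Finite ι := .of_injective (Sum.inl : ι → ι ⊕ Unit) Sum.inl_injective
  have hc := Nat.card_congr i
  rw [Nat.card_sum, Nat.card_sum, Nat.add_right_cancel_iff,
    Nat.card_eq_one_iff_unique.2 ⟨inferInstanceAs (Subsingleton Unit), ⟨()⟩⟩] at hc
  obtain ⟨hs, ⟨i₀⟩⟩ := Nat.card_eq_one_iff_unique.1 hc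
  refine ⟨b i₀, ?_⟩
  have hr : Set.range b = {b i₀} := by
    ext x
    simp only [Set.mem_range, Set.mem_singleton_iff]
    exact ⟨fun ⟨j, hj⟩ => by rw [← hj, Subsingleton.elim j i₀], fun hx => ⟨i₀, hx.symm⟩⟩
  have := congrArg (Submodule.map I.subtype) b.span_eq
  rw [hr, Submodule.map_span, Submodule.map_top, Submodule.range_subtype, Set.image_singleton]
    at this
  exact this.symm

/-! ### Degrees in Ore extensions -/

/-- `S` is an Ore extension of the domain `B` in the variable `x`, with left coefficients; the
automorphism and the derivation are left implicit. -/
structure IsLeftOreExtension {B S : Type*} [Ring B] [Ring S] (ι : B →+* S) (x : S) : Prop where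
  comm : ∀ b, ∃ b' b'', x * ι b = ι b' * x + ι b'' ∧ (b ≠ 0 → b' ≠ 0)
  bijective : Function.Bijective fun p : B[X] => p.eval₂ ι x

section

variable {B S : Type*} [Ring B] [Ring S] {ι : B →+* S} {x : S}

theorem eval₂_eraseLead_add (p : B[X]) :
    p.eval₂ ι x = p.eraseLead.eval₂ ι x + ι p.leadingCoeff * x ^ p.natDegree := by
  conv_lhs => rw [← p.eraseLead_add_monomial_natDegree_leadingCoeff]
  rw [eval₂_add, eval₂_monomial]

/-- When `x` does not commute with the coefficients, `eval₂` is additive but not multiplicative, so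
products are handled one leading term at a time. -/
theorem induction_eraseLead {P : B[X] → Prop} (h0 : P 0)
    (h : ∀ p : B[X], p ≠ 0 → P p.eraseLead → P p) (p : B[X]) : P p := by
  induction hn : p.support.card using Nat.strong_induction_on generalizing p with
  | _ n ih =>
    by_cases hp : p = 0
    · rwa [hp]
    · exact h p hp (ih _ (hn ▸ eraseLead_support_card_lt hp) _ rfl)

/-- The commutation rule pushes `x` through left coefficients, raising the degree by one. -/
theorem exists_eval₂_eq_mul_eval₂
    (hc : ∀ b, ∃ b' b'', x * ι b = ι b' * x + ι b'' ∧ (b ≠ 0 → b' ≠ 0)) (q : B[X]) :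
    ∃ r : B[X], r.eval₂ ι x = x * q.eval₂ ι x ∧ r.degree = q.degree + 1 := by
  induction q using induction_eraseLead with
  | h0 => exact ⟨0, by simp⟩
  | h q hq ih =>
    obtain ⟨r, hr, hd⟩ := ih
    obtain ⟨b', b'', hb, hb'⟩ := hc q.leadingCoeff
    have hb' := hb' (leadingCoeff_ne_zero.2 hq)
    refine ⟨monomial (q.natDegree + 1) b' + (monomial q.natDegree b'' + r), ?_, ?_⟩
    · rw [eval₂_eraseLead_add q, mul_add, ← hr, ← mul_assoc, hb, eval₂_add, eval₂_add,
        eval₂_monomial, eval₂_monomial, pow_succ']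
      noncomm_ring
    · have h1 : (monomial (q.natDegree + 1) b').degree = q.degree + 1 := by
        rw [degree_monomial _ hb', degree_eq_natDegree hq]
        rfl
      have h2 : (q.natDegree : WithBot ℕ) < q.degree + 1 := by
        rw [degree_eq_natDegree hq]
        exact_mod_cast Nat.lt_succ_self _
      have h3 : r.degree < q.degree + 1 := by
        have := degree_eraseLead_lt hq
        rw [hd]
        rw [degree_eq_natDegree hq] at this ⊢
        by_cases he : q.eraseLead = 0
        · rw [he, degree_zero]
          exact WithBot.bot_lt_coe _
        · rw [degree_eq_natDegree he] at this ⊢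
          exact_mod_cast Nat.succ_lt_succ (by exact_mod_cast this)
      rw [← h1]
      refine degree_add_eq_left_of_degree_lt ((degree_add_le _ _).trans_lt (max_lt ?_ ?_))
      · rw [h1]
        exact (degree_monomial_le _ _).trans_lt h2
      · rwa [h1]

theorem exists_eval₂_eq_pow_mul_eval₂
    (hc : ∀ b, ∃ b' b'', x * ι b = ι b' * x + ι b'' ∧ (b ≠ 0 → b' ≠ 0)) (n : ℕ) (q : B[X]) :
    ∃ r : B[X], r.eval₂ ι x = x ^ n * q.eval₂ ι x ∧ r.degree = q.degree + n := by
  induction n with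
  | zero => exact ⟨q, by simp⟩
  | succ n ih =>
    obtain ⟨r, hr, hd⟩ := ih
    obtain ⟨r', hr', hd'⟩ := exists_eval₂_eq_mul_eval₂ hc r
    exact ⟨r', by rw [hr', hr, pow_succ', mul_assoc],
      by rw [hd', hd, Nat.cast_succ, add_assoc]⟩

/-- Degrees add: moving powers of `x` past the leading coefficient of `q` keeps it nonzero, and `B`
has no zero divisors. -/
theorem exists_eval₂_eq_mul [NoZeroDivisors B]
    (hc : ∀ b, ∃ b' b'', x * ι b = ι b' * x + ι b'' ∧ (b ≠ 0 → b' ≠ 0)) (p q : B[X]) :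
    ∃ r : B[X], r.eval₂ ι x = p.eval₂ ι x * q.eval₂ ι x ∧ r.degree = p.degree + q.degree := by
  by_cases hq : q = 0
  · exact ⟨0, by simp [hq]⟩
  induction p using induction_eraseLead with
  | h0 => exact ⟨0, by simp⟩
  | h p hp ih =>
    obtain ⟨r, hr, hd⟩ := ih
    obtain ⟨s, hs, hds⟩ := exists_eval₂_eq_pow_mul_eval₂ hc p.natDegree q
    have hdeg : (C p.leadingCoeff * s).degree = p.degree + q.degree := by
      rw [degree_C_mul_of_mul_ne_zero, hds, degree_eq_natDegree hp, add_comm]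
      refine mul_ne_zero (leadingCoeff_ne_zero.2 hp) (leadingCoeff_ne_zero.2 fun h => ?_)
      rw [h, degree_zero, degree_eq_natDegree hq] at hds
      exact WithBot.bot_ne_coe hds
    refine ⟨C p.leadingCoeff * s + r, ?_, ?_⟩
    · rw [eval₂_eraseLead_add p, add_mul, ← hr, mul_assoc, ← hs, eval₂_add, add_comm,
        ← smul_eq_C_mul, eval₂_smul]
    · rw [← hdeg]
      refine degree_add_eq_left_of_degree_lt ?_
      rw [hd, hdeg]
      have := degree_eraseLead_lt hp
      rw [degree_eq_natDegree hq]
      exact WithBot.add_lt_add_right WithBot.coe_ne_bot this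

/-- The elements whose left multiplication preserves the set of normal forms are a subalgebra. It
contains the generators, and `1` is a normal form. -/
theorem eval₂_surjective_of_adjoin_eq_top {k : Type*} [CommRing k] [Algebra k S]
    (hc : ∀ b, ∃ b' b'', x * ι b = ι b' * x + ι b'' ∧ (b ≠ 0 → b' ≠ 0))
    {s : Set S} (hk : ∀ c : k, algebraMap k S c ∈ ι.range) (hs : ∀ y ∈ s, y ∈ ι.range ∨ y = x)
    (htop : Algebra.adjoin k s = ⊤) : Function.Surjective fun p : B[X] => p.eval₂ ι x := by
  suffices h : ∀ y : S, ∀ q : B[X], ∃ r : B[X], r.eval₂ ι x = y * q.eval₂ ι x by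
    intro y
    obtain ⟨r, hr⟩ := h y 1
    exact ⟨r, by simpa using hr⟩
  have hι : ∀ y ∈ ι.range, ∀ q : B[X], ∃ r : B[X], r.eval₂ ι x = y * q.eval₂ ι x := by
    rintro _ ⟨b, rfl⟩ q
    exact ⟨C b * q, by rw [← smul_eq_C_mul, eval₂_smul]⟩
  intro y
  have hy : y ∈ Algebra.adjoin k s := htop ▸ Algebra.mem_top
  induction hy using Algebra.adjoin_induction with
  | mem y hy =>
    obtain h | rfl := hs y hy
    · exact hι y h
    · exact fun q => (exists_eval₂_eq_mul_eval₂ hc q).imp fun _ h => h.1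
  | algebraMap c => exact hι _ (hk c)
  | add y z _ _ hy hz =>
    intro q
    obtain ⟨r, hr⟩ := hy q
    obtain ⟨r', hr'⟩ := hz q
    exact ⟨r + r', by rw [eval₂_add, hr, hr', add_mul]⟩
  | mul y z _ _ hy hz =>
    intro q
    obtain ⟨r, hr⟩ := hz q
    obtain ⟨r', hr'⟩ := hy r
    exact ⟨r', by rw [hr', hr, mul_assoc]⟩

namespace IsLeftOreExtension

variable [NoZeroDivisors B] (h : IsLeftOreExtension ι x)

include h

theorem noZeroDivisors : NoZeroDivisors S := by
  refine ⟨fun {y z} hyz => ?_⟩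
  obtain ⟨p, rfl⟩ := h.bijective.2 y
  obtain ⟨q, rfl⟩ := h.bijective.2 z
  obtain ⟨r, hr, hd⟩ := exists_eval₂_eq_mul h.comm p q
  have : r = 0 := h.bijective.1 (by simpa using hr.trans hyz)
  rw [this, degree_zero, eq_comm, WithBot.add_eq_bot, degree_eq_bot, degree_eq_bot] at hd
  exact hd.imp (by rintro rfl; simp) (by rintro rfl; simp)

/-- A factor of a nonzero constant is a constant. -/
theorem mem_range_of_mul_eq {y z : S} {b : B} (hb : b ≠ 0) (hyz : y * z = ι b) :
    y ∈ ι.range ∧ z ∈ ι.range := by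
  obtain ⟨p, rfl⟩ := h.bijective.2 y
  obtain ⟨q, rfl⟩ := h.bijective.2 z
  obtain ⟨r, hr, hd⟩ := exists_eval₂_eq_mul h.comm p q
  have : r = C b := h.bijective.1 (by simpa using hr.trans hyz)
  rw [this, degree_C hb] at hd
  have hp : p ≠ 0 := by rintro rfl; simp at hd
  have hq : q ≠ 0 := by rintro rfl; simp at hd
  rw [degree_eq_natDegree hp, degree_eq_natDegree hq] at hd
  have hd : 0 = p.natDegree + q.natDegree := by exact_mod_cast hd
  rw [eq_C_of_natDegree_eq_zero (p := p) (by omega), eq_C_of_natDegree_eq_zero (p := q) (by omega)]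
  simp

end IsLeftOreExtension

end

/-! ### Presentation and normal forms of the down-up algebra -/

namespace DownUpAlgebra

variable {k : Type*} [Field k] {α β γ : k}

theorem d_mul_u_sq : d α β γ * u α β γ ^ 2 =
    α • (u α β γ * d α β γ * u α β γ) + β • (u α β γ ^ 2 * d α β γ) + γ • u α β γ := by
  simpa [u, d] using RingQuot.mkAlgHom_rel k (DownUpRel.up (α := α) (β := β) (γ := γ))

theorem d_sq_mul_u : d α β γ ^ 2 * u α β γ =
    α • (d α β γ * u α β γ * d α β γ) + β • (u α β γ * d α β γ ^ 2) + γ • d α β γ := by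
  simpa [u, d] using RingQuot.mkAlgHom_rel k (DownUpRel.down (α := α) (β := β) (γ := γ))

/-- The homomorphism out of a down-up algebra given by a pair of elements that satisfies the
defining relations. -/
def lift {S : Type*} [Ring S] [Algebra k S] (v e : S)
    (hup : e * v ^ 2 = α • (v * e * v) + β • (v ^ 2 * e) + γ • v)
    (hdown : e ^ 2 * v = α • (e * v * e) + β • (v * e ^ 2) + γ • e) :
    DownUpAlgebra k α β γ →ₐ[k] S :=
  RingQuot.liftAlgHom k ⟨FreeAlgebra.lift k fun i => DownUpGen.casesOn i v e, by
    rintro _ _ (_ | _) <;> simpa⟩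

section

variable {S : Type*} [Ring S] [Algebra k S] (v e : S)
    (hup : e * v ^ 2 = α • (v * e * v) + β • (v ^ 2 * e) + γ • v)
    (hdown : e ^ 2 * v = α • (e * v * e) + β • (v * e ^ 2) + γ • e)

theorem lift_u : lift v e hup hdown (u α β γ) = v := by
  simp [lift, u]

theorem lift_d : lift v e hup hdown (d α β γ) = e := by
  simp [lift, d]

end

theorem adjoin_u_d : Algebra.adjoin k {u α β γ, d α β γ} = ⊤ := by
  have h := congrArg (Subalgebra.map (RingQuot.mkAlgHom k (DownUpRel k α β γ)))
    (FreeAlgebra.adjoin_range_ι k DownUpGen)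
  rw [AlgHom.map_adjoin, Algebra.map_top,
    (AlgHom.range_eq_top _).2 (RingQuot.mkAlgHom_surjective k _)] at h
  rw [← h]
  congr 1
  ext y
  constructor
  · rintro (rfl | rfl)
    · exact ⟨_, ⟨.u, rfl⟩, rfl⟩
    · exact ⟨_, ⟨.d, rfl⟩, rfl⟩
  · rintro ⟨_, ⟨_ | _, rfl⟩, rfl⟩
    · exact .inl rfl
    · exact .inr rfl

/-! ### Representations on sequences -/

section Representation

variable {R : Type*} [CommRing R] [Algebra k R] (φ : R ≃ₐ[k] R) (x : R)

/-- The shift on two-sided sequences. -/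
def shiftOp (k R : Type*) [Field k] [CommRing R] [Algebra k R] : Module.End k (ℤ → R) where
  toFun v n := v (n - 1)
  map_add' _ _ := rfl
  map_smul' _ _ := rfl

/-- The backward shift on two-sided sequences, weighted by the orbit of `x` under `φ`. -/
def weightedShiftOp : Module.End k (ℤ → R) where
  toFun v n := (φ ^ (n + 1)) x * v (n + 1)
  map_add' v v' := by ext n; simp [mul_add]
  map_smul' c v := by ext n; simp

theorem shiftOp_apply (v : ℤ → R) (n : ℤ) : shiftOp k R v n = v (n - 1) := rfl

theorem weightedShiftOp_apply (v : ℤ → R) (n : ℤ) :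
    weightedShiftOp φ x v n = (φ ^ (n + 1)) x * v (n + 1) := rfl

variable {φ x} (hx : φ (φ x) = α • φ x + β • x + algebraMap k R γ)

include hx in
theorem zpow_recurrence (n : ℤ) :
    (φ ^ (n + 1 + 1)) x = α • (φ ^ (n + 1)) x + β • (φ ^ n) x + algebraMap k R γ := by
  have h := congrArg (φ ^ n) hx
  simpa only [zpow_add_one, AlgEquiv.mul_apply, map_add, map_smul, AlgEquiv.commutes] using h

/-- The representation of the down-up algebra on two-sided sequences. -/
noncomputable def rep : DownUpAlgebra k α β γ →ₐ[k] Module.End k (ℤ → R) :=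
  lift (shiftOp k R) (weightedShiftOp φ x)
    (by
      ext v n
      -- At position `n` each word in the relation multiplies `v (n - 1)` by a weight; the weights
      -- are the terms with exponents `n + 1`, `n` and `n - 1`.
      have h := zpow_recurrence hx (n - 1)
      simp only [sub_add_cancel] at h
      simp only [Module.End.mul_apply, pow_two, LinearMap.add_apply, LinearMap.smul_apply,
        Pi.add_apply, Pi.smul_apply, shiftOp_apply, weightedShiftOp_apply, add_sub_cancel_right,
        sub_add_cancel, h]
      simp only [Algebra.smul_def]
      ring_nf)
    (by
      ext v n
      have h := zpow_recurrence hx n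
      simp only [Module.End.mul_apply, pow_two, LinearMap.add_apply, LinearMap.smul_apply,
        Pi.add_apply, Pi.smul_apply, shiftOp_apply, weightedShiftOp_apply, add_sub_cancel_right, h]
      simp only [Algebra.smul_def]
      ring_nf)

theorem rep_u_apply (v : ℤ → R) (n : ℤ) : rep hx (u α β γ) v n = v (n - 1) := by
  rw [rep, lift_u, shiftOp_apply]

theorem rep_d_apply (v : ℤ → R) (n : ℤ) :
    rep hx (d α β γ) v n = (φ ^ (n + 1)) x * v (n + 1) := by
  rw [rep, lift_d, weightedShiftOp_apply]

theorem rep_u_pow_apply (i : ℕ) (v : ℤ → R) (n : ℤ) :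
    rep hx (u α β γ ^ i) v n = v (n - i) := by
  induction i generalizing n with
  | zero => simp
  | succ i ih =>
    rw [pow_succ', map_mul, Module.End.mul_apply, rep_u_apply, ih]
    congr 1
    push_cast
    ring

theorem rep_aeval_u_apply (p : k[X]) (v : ℤ → R) (n : ℤ) :
    rep hx (aeval (u α β γ) p) v n = p.sum fun i c => c • v (n - i) := by
  rw [aeval_eq_sum_range, map_sum, LinearMap.sum_apply, Finset.sum_apply,
    sum_over_range p (by simp)]
  simp only [map_smul, LinearMap.smul_apply, Pi.smul_apply, rep_u_pow_apply]

variable {lam : k} {w : R} (hw : φ x = lam • x + γ • w) (hγ : γ ≠ 0)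

include hw hγ

/-- At position `n`, `d u` multiplies by `φⁿ⁺¹ x` and `u d` by `φⁿ x`; by `hw` their weighted
difference leaves only `φⁿ w`. -/
theorem rep_omega_apply (v : ℤ → R) (n : ℤ) :
    rep hx (omega α β γ lam) v n = (φ ^ n) w * v n := by
  have h : (φ ^ (n + 1)) x = lam • (φ ^ n) x + γ • (φ ^ n) w := by
    rw [zpow_add_one, AlgEquiv.mul_apply, hw, map_add, map_smul, map_smul]
  simp only [omega, map_smul, map_sub, map_mul, LinearMap.smul_apply, LinearMap.sub_apply,
    Pi.smul_apply, Pi.sub_apply, Module.End.mul_apply, rep_u_apply, rep_d_apply,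
    add_sub_cancel_right, sub_add_cancel, h]
  rw [add_mul, smul_mul_assoc, smul_mul_assoc, add_sub_cancel_left, inv_smul_smul₀ hγ]

theorem rep_omega_pow_apply (i : ℕ) (v : ℤ → R) (n : ℤ) :
    rep hx (omega α β γ lam ^ i) v n = (φ ^ n) w ^ i * v n := by
  induction i with
  | zero => simp
  | succ i ih =>
    rw [pow_succ', map_mul, Module.End.mul_apply, rep_omega_apply hx hw hγ, ih, pow_succ',
      mul_assoc]

theorem rep_aeval_omega_apply (p : k[X]) (v : ℤ → R) (n : ℤ) :
    rep hx (aeval (omega α β γ lam) p) v n = (φ ^ n) (aeval w p) * v n := by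
  rw [aeval_eq_sum_range, aeval_eq_sum_range, map_sum, LinearMap.sum_apply, Finset.sum_apply,
    map_sum, Finset.sum_mul]
  simp only [map_smul, LinearMap.smul_apply, Pi.smul_apply, rep_omega_pow_apply hx hw hγ,
    map_pow (φ ^ n), smul_mul_assoc]

theorem rep_eval₂_apply (p : k[X][X]) (v : ℤ → R) (n : ℤ) :
    rep hx (p.eval₂ (aeval (omega α β γ lam) : k[X] →ₐ[k] _).toRingHom (u α β γ)) v n =
      p.sum fun i f => (φ ^ n) (aeval w f) * v (n - i) := by
  rw [eval₂_eq_sum, Polynomial.sum, Polynomial.sum, map_sum, LinearMap.sum_apply, Finset.sum_apply]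
  refine Finset.sum_congr rfl fun i _ => ?_
  rw [map_mul, Module.End.mul_apply, ← rep_u_pow_apply hx i v n]
  exact rep_aeval_omega_apply hx hw hγ _ _ _

omit hw hγ in
theorem rep_d_pow_single (i : ℕ) :
    rep hx (d α β γ ^ i) (Pi.single 0 1) =
      Pi.single (-(i : ℤ)) (∏ j ∈ Finset.range i, (φ ^ (-(j : ℤ))) x) := by
  induction i with
  | zero => simp
  | succ i ih =>
    rw [pow_succ', map_mul, Module.End.mul_apply, ih]
    ext n
    rw [rep_d_apply, Finset.prod_range_succ, mul_comm]
    by_cases h : n + 1 = -(i : ℤ)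
    · obtain rfl : n = -((i + 1 : ℕ) : ℤ) := by push_cast; omega
      rw [h, Pi.single_eq_same, Pi.single_eq_same]
    · rw [Pi.single_eq_of_ne h, Pi.single_eq_of_ne (by push_cast; omega), zero_mul]

end Representation

/-! ### The polynomial representation -/

/-- The automorphism `X ↦ μ X + 1` of `k[X]`. -/
noncomputable def baseAut {mu : k} (hmu : mu ≠ 0) : k[X] ≃ₐ[k] k[X] :=
  letI := invertibleOfNonzero hmu
  algEquivCMulXAddC mu 1

theorem baseAut_X {mu : k} (hmu : mu ≠ 0) : baseAut hmu X = C mu * X + 1 := by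
  simp [baseAut]

/-- The automorphism of `k[X][Y]` that extends `baseAut` and sends `Y` to `λ Y + γ X`. -/
noncomputable def bivariateAut {lam mu : k} (hlam : lam ≠ 0) (hmu : mu ≠ 0) (γ : k) :
    k[X][X] ≃ₐ[k] k[X][X] :=
  letI : Invertible (C lam : k[X]) := ⟨C lam⁻¹, by rw [← C_mul, inv_mul_cancel₀ hlam, C_1],
    by rw [← C_mul, mul_inv_cancel₀ hlam, C_1]⟩
  (mapAlgEquiv (baseAut hmu)).trans
    ((algEquivCMulXAddC (C lam : k[X]) (C γ * X)).restrictScalars k)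

section

variable {lam mu : k} (hlam : lam ≠ 0) (hmu : mu ≠ 0)

theorem bivariateAut_C (f : k[X]) :
    bivariateAut hlam hmu γ (C f) = C (baseAut hmu f) := by
  simp [bivariateAut]

theorem bivariateAut_X : bivariateAut hlam hmu γ X = lam • (X : k[X][X]) + γ • C X := by
  simp [bivariateAut, Algebra.smul_def]

/-- The automorphism acts bijectively on coefficients and then substitutes a linear polynomial with
leading coefficient `λ ≠ 0`. -/
theorem degree_bivariateAut (p : k[X][X]) : (bivariateAut hlam hmu γ p).degree = p.degree := by
  have h1 : (C (C lam) * X + C (C γ * X) : k[X][X]).natDegree = 1 :=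
    natDegree_linear (C_ne_zero.2 hlam)
  have h2 : (p.map (baseAut hmu : k[X] →+* k[X])).degree = p.degree :=
    degree_map_eq_of_injective (baseAut hmu).injective p
  rw [← h2]
  by_cases hp : p = 0
  · simp [hp]
  have hq : bivariateAut hlam hmu γ p ≠ 0 := by simpa using hp
  have h3 : bivariateAut hlam hmu γ p =
      (p.map (baseAut hmu : k[X] →+* k[X])).comp (C (C lam) * X + C (C γ * X)) := by
    simp [bivariateAut, comp_eq_aeval]
  have hp' : p.map (baseAut hmu : k[X] →+* k[X]) ≠ 0 := by
    rw [← degree_ne_bot, h2, degree_ne_bot]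
    exact hp
  rw [degree_eq_natDegree hq, degree_eq_natDegree hp', h3, natDegree_comp, h1, mul_one]

theorem zpow_bivariateAut_C (n : ℤ) (f : k[X]) :
    (bivariateAut hlam hmu γ ^ n) (C f) = C ((baseAut hmu ^ n) f) := by
  induction n generalizing f with
  | zero => simp
  | succ n ih =>
    rw [zpow_add_one, zpow_add_one, AlgEquiv.mul_apply, AlgEquiv.mul_apply, bivariateAut_C, ih]
  | pred n ih =>
    have h : ∀ g, (bivariateAut hlam hmu γ)⁻¹ (C g) = C ((baseAut hmu)⁻¹ g) := by
      intro g
      rw [AlgEquiv.aut_inv, AlgEquiv.symm_apply_eq, bivariateAut_C, AlgEquiv.aut_inv,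
        AlgEquiv.apply_symm_apply]
    rw [zpow_sub_one, zpow_sub_one, AlgEquiv.mul_apply, AlgEquiv.mul_apply, h, ih]

theorem degree_zpow_bivariateAut (n : ℤ) (p : k[X][X]) :
    ((bivariateAut hlam hmu γ ^ n) p).degree = p.degree := by
  induction n generalizing p with
  | zero => simp
  | succ n ih => rw [zpow_add_one, AlgEquiv.mul_apply, ih, degree_bivariateAut]
  | pred n ih =>
    rw [zpow_sub_one, AlgEquiv.mul_apply, ih, ← degree_bivariateAut hlam hmu (γ := γ),
      AlgEquiv.aut_inv, AlgEquiv.apply_symm_apply]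

/-- With `w = C X` one has `φ x = λ x + γ w` and `φ w = μ w + 1`; eliminating `w` gives the
second-order recurrence. -/
theorem bivariateAut_recurrence (hα : α = lam + mu) (hβ : β = -(lam * mu)) :
    bivariateAut hlam hmu γ (bivariateAut hlam hmu γ X) =
      α • bivariateAut hlam hmu γ X + β • (X : k[X][X]) + algebraMap k k[X][X] γ := by
  have h1 : algebraMap k k[X][X] γ = γ • 1 := Algebra.algebraMap_eq_smul_one γ
  have h2 : (C (C mu * X + 1) : k[X][X]) = mu • C X + 1 := by
    simp [Algebra.smul_def]
  rw [bivariateAut_X, map_add, map_smul, map_smul, bivariateAut_X, bivariateAut_C, baseAut_X,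
    h1, h2, hα, hβ]
  module

/-- The products of weights through which the powers of `d` act. -/
noncomputable def weightSequence (γ : k) : Polynomial.Sequence k[X] where
  elems' i := ∏ j ∈ Finset.range i, (bivariateAut hlam hmu γ ^ (-(j : ℤ))) X
  degree_eq' i := by
    simp only [degree_prod, degree_zpow_bivariateAut, degree_X, Finset.sum_const, Finset.card_range,
      nsmul_one]

variable (hα : α = lam + mu) (hβ : β = -(lam * mu)) (hγ : γ ≠ 0)
include hα hβ hγ hlam hmu

/-- Applied to the delta sequence at `0`, `f(ω) uʲ dⁱ` is supported at `j - i`, with value a twist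
of `f` times the `i`-th weight product. These products have degree `i` in the outer variable, so
they are independent over `k[X]`. -/
theorem eq_zero_of_sum_eval₂_mul_d_pow {s : Finset ℕ} {c : ℕ → k[X][X]}
    (h : ∑ i ∈ s, (c i).eval₂ (aeval (omega α β γ lam) : k[X] →ₐ[k] _).toRingHom (u α β γ) *
      d α β γ ^ i = 0) : ∀ i ∈ s, c i = 0 := by
  have hx := bivariateAut_recurrence hlam hmu (γ := γ) hα hβ
  have hw := bivariateAut_X hlam hmu (γ := γ)
  intro i₀ hi₀
  ext1 j₀
  -- At this position exactly the monomials with `j - i = j₀ - i₀` contribute, hence one `j` at most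
  -- for each `i`.
  let n : ℤ := j₀ - i₀
  let g : ℕ → k[X] := fun i =>
    (c i).sum fun j f => if n - j = -(i : ℤ) then (baseAut hmu ^ n) f else 0
  have h1 := congrFun (congrArg (fun T => rep hx T (Pi.single 0 1)) h) n
  simp only [map_sum, LinearMap.sum_apply, Finset.sum_apply, map_mul, Module.End.mul_apply,
    rep_d_pow_single, map_zero, LinearMap.zero_apply, Pi.zero_apply] at h1
  have h2 : ∑ i ∈ s, g i • weightSequence hlam hmu γ i = 0 := by
    rw [← h1]
    refine Finset.sum_congr rfl fun i _ => ?_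
    rw [rep_eval₂_apply hx hw hγ]
    simp only [g, Polynomial.sum, Finset.sum_smul]
    refine Finset.sum_congr rfl fun j _ => ?_
    have : aeval (C X : k[X][X]) ((c i).coeff j) = C ((c i).coeff j) := by
      have := aeval_algebraMap_apply k[X][X] (X : k[X]) ((c i).coeff j)
      rwa [aeval_X_left_apply] at this
    rw [this, zpow_bivariateAut_C, ite_smul, zero_smul]
    split_ifs with hj
    · rw [hj, Pi.single_eq_same, smul_eq_C_mul]
      rfl
    · rw [Pi.single_eq_of_ne hj, mul_zero]
  have h3 := linearIndependent_iff'.1 (weightSequence hlam hmu γ).linearIndependent s g h2 i₀ hi₀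
  have h4 : ∀ j : ℕ, n - j = -(i₀ : ℤ) ↔ j = j₀ := fun j => by simp only [n]; omega
  simp only [g, h4, Polynomial.sum, Finset.sum_ite_eq'] at h3
  split_ifs at h3 with hj
  · simpa using h3
  · rw [coeff_zero]
    exact notMem_support_iff.1 hj

/-- On the delta sequence, position `j₀` sees only the coefficients of `u ^ j₀`, as a twisted
polynomial in the transcendental `C X`. -/
theorem eq_zero_of_sum_omega_pow_mul_aeval_u {s : Finset ℕ} {c : ℕ → k[X]}
    (h : ∑ i ∈ s, omega α β γ lam ^ i * aeval (u α β γ) (c i) = 0) : ∀ i ∈ s, c i = 0 := by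
  have hx := bivariateAut_recurrence hlam hmu (γ := γ) hα hβ
  have hw := bivariateAut_X hlam hmu (γ := γ)
  intro i₀ hi₀
  ext1 j₀
  have h1 := congrFun (congrArg (fun T => rep hx T (Pi.single 0 1)) h) j₀
  simp only [map_sum, LinearMap.sum_apply, Finset.sum_apply, map_mul, Module.End.mul_apply,
    map_zero, LinearMap.zero_apply, Pi.zero_apply, rep_omega_pow_apply hx hw hγ,
    rep_aeval_u_apply] at h1
  have h2 : ∀ i, ((c i).sum fun j a => a • (Pi.single 0 1 : ℤ → k[X][X]) (j₀ - j)) =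
      C (C ((c i).coeff j₀)) := by
    intro i
    have h4 : ∀ j : ℕ, (j₀ : ℤ) - j = 0 ↔ j = j₀ := fun j => by omega
    simp only [Pi.single_apply, h4, Polynomial.sum, smul_ite, smul_zero, Finset.sum_ite_eq']
    split_ifs with hj
    · simp [Algebra.smul_def]
    · rw [notMem_support_iff.1 hj, C_0, C_0]
  have h3 : (bivariateAut hlam hmu γ ^ (j₀ : ℤ))
      (C (∑ i ∈ s, monomial i ((c i).coeff j₀))) = 0 := by
    rw [← h1, map_sum, map_sum]
    refine Finset.sum_congr rfl fun i _ => ?_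
    rw [h2, ← C_mul_X_pow_eq_monomial, C_mul, C_pow, map_mul, map_pow, mul_comm]
    congr 1
    exact AlgEquiv.commutes _ _
  rw [map_eq_zero_iff _ (AlgEquiv.injective _), C_eq_zero] at h3
  have h5 := congrArg (fun p => coeff p i₀) h3
  simpa [finsetSum_coeff, coeff_monomial, hi₀] using h5

end

end DownUpAlgebra

namespace DownUpAlgebra

variable {k : Type*} [Field k] {α β γ lam mu : k}

/-! ### The colon ideal in an algebra with a `q`-commuting pair -/

section Pair

variable {S : Type*} [Ring S] [Algebra k S] {v w : S}

/-- The scalar multiples of `w` cancel, and `h` cancels `μ v w + v` against `w v`. -/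
theorem bezout_of_comm (h : w * v = mu • (v * w) + v) :
    (1 + v) * (mu • w + 1) - w * (v + algebraMap k S mu) = 1 := by
  rw [mul_add w, h, ← Algebra.commutes, ← Algebra.smul_def, mul_add, add_mul,
    mul_smul_comm mu v w, one_mul, mul_one]
  abel

/-- With `genB_eq`, this matches `a` and `b`, up to nonzero scalars, to the generators `1 - p r` and
`p w` for `p = μ w + 1`, `r = 1 + v`. -/
theorem genA_eq (hmu : mu ≠ 0) :
    genA mu v w = (1 - (mu • w + 1) * (1 + v)) * algebraMap k S (-mu⁻¹) := by
  rw [← Algebra.commutes, ← Algebra.smul_def, smul_sub, ← smul_mul_assoc, smul_add, smul_smul,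
    neg_mul, inv_mul_cancel₀ hmu, genA, Algebra.algebraMap_eq_smul_one, neg_smul, neg_smul,
    one_smul]
  noncomm_ring

theorem genB_eq (hmu : mu ≠ 0) :
    genB mu w = (mu • w + 1) * w * algebraMap k S mu⁻¹ := by
  rw [← Algebra.commutes, ← Algebra.smul_def, ← smul_mul_assoc, smul_add, smul_smul,
    inv_mul_cancel₀ hmu, one_smul, genB, add_mul, pow_two, smul_one_mul]

theorem rightIdealPair_mul_algebraMap {a b : S} {r s : k} (hr : r ≠ 0) (hs : s ≠ 0) :
    rightIdealPair (a * algebraMap k S r) (b * algebraMap k S s) = rightIdealPair a b := by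
  ext x
  rw [mem_rightIdealPair, mem_rightIdealPair]
  constructor
  · rintro ⟨y, z, rfl⟩
    exact ⟨_, _, by rw [mul_assoc, mul_assoc]⟩
  · rintro ⟨y, z, rfl⟩
    refine ⟨algebraMap k S r⁻¹ * y, algebraMap k S s⁻¹ * z, ?_⟩
    rw [mul_assoc a, mul_assoc b, ← mul_assoc _ _ y, ← mul_assoc _ _ z, ← map_mul, ← map_mul,
      mul_inv_cancel₀ hr, mul_inv_cancel₀ hs, map_one, one_mul, one_mul]

theorem rightColon_eq_rightIdealPair_genA_genB (hmu : mu ≠ 0) (h : w * v = mu • (v * w) + v) :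
    rightColon (1 + v) w = rightIdealPair (genA mu v w) (genB mu w) := by
  rw [rightColon_eq_rightIdealPair (bezout_of_comm h), genA_eq hmu, genB_eq hmu,
    rightIdealPair_mul_algebraMap (neg_ne_zero.2 (inv_ne_zero hmu)) (inv_ne_zero hmu)]

theorem map_genA {S' : Type*} [Ring S'] [Algebra k S'] (f : S →ₐ[k] S') :
    f (genA mu v w) = genA mu (f v) (f w) := by
  simp [genA]

theorem map_genB {S' : Type*} [Ring S'] [Algebra k S'] (f : S →ₐ[k] S') :
    f (genB mu w) = genB mu (f w) := by
  simp [genB]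

theorem aeval_mul_eq_mul_aeval (hmu : mu ≠ 0) (h : w * v = mu • (v * w) + v) (f : k[X]) :
    aeval w f * v = v * aeval w (baseAut hmu f) := by
  induction f using Polynomial.induction_on with
  | C a =>
    rw [show baseAut hmu (C a) = C a from (baseAut hmu).commutes a, aeval_C, Algebra.commutes]
  | add p q hp hq => rw [map_add, map_add, map_add, add_mul, mul_add, hp, hq]
  | monomial n a ih =>
    have h' : w * v = v * aeval w (C mu * X + 1) := by
      simp [h, mul_add, ← Algebra.smul_def]
    rw [pow_succ, ← mul_assoc, map_mul (aeval w) (C a * X ^ n), map_mul (baseAut hmu),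
      map_mul (aeval w) (baseAut hmu (C a * X ^ n)), aeval_X, mul_assoc, h', ← mul_assoc, ih,
      mul_assoc, baseAut_X]

theorem mul_aeval_eq_aeval_mul (hmu : mu ≠ 0) (h : v * w = mu • (w * v) + v) (f : k[X]) :
    v * aeval w f = aeval w (baseAut hmu f) * v := by
  induction f using Polynomial.induction_on with
  | C a =>
    rw [show baseAut hmu (C a) = C a from (baseAut hmu).commutes a, aeval_C, Algebra.commutes]
  | add p q hp hq => rw [map_add, map_add, map_add, add_mul, mul_add, hp, hq]
  | monomial n a ih =>
    have h' : v * w = aeval w (C mu * X + 1) * v := by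
      simp [h, add_mul, ← Algebra.smul_def]
    rw [pow_succ, ← mul_assoc, map_mul (aeval w) (C a * X ^ n), map_mul (baseAut hmu),
      map_mul (aeval w) (baseAut hmu (C a * X ^ n)), aeval_X, ← mul_assoc, ih, mul_assoc, h',
      ← mul_assoc, baseAut_X]

end Pair

/-! ### Commutation relations -/

section Relations

variable (hγ : γ ≠ 0)
include hγ

theorem gamma_smul_omega :
    γ • omega α β γ lam = d α β γ * u α β γ - lam • (u α β γ * d α β γ) := by
  rw [omega, smul_inv_smul₀ hγ]

theorem d_mul_u :
    d α β γ * u α β γ = lam • (u α β γ * d α β γ) + γ • omega α β γ lam := by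
  rw [gamma_smul_omega hγ]
  abel

variable (hα : α = lam + mu) (hβ : β = -(lam * mu))
include hα hβ

theorem omega_mul_u : omega α β γ lam * u α β γ =
    mu • (u α β γ * omega α β γ lam) + u α β γ := by
  apply smul_right_injective _ hγ
  simp only [smul_add, smul_comm γ mu]
  rw [← smul_mul_assoc, ← mul_smul_comm, gamma_smul_omega hγ, sub_mul, mul_assoc, ← pow_two,
    d_mul_u_sq, hα, hβ]
  simp only [mul_sub, mul_smul_comm, smul_mul_assoc, pow_two, mul_assoc]
  module

theorem d_mul_omega : d α β γ * omega α β γ lam =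
    mu • (omega α β γ lam * d α β γ) + d α β γ := by
  apply smul_right_injective _ hγ
  simp only [smul_add, smul_comm γ mu]
  rw [← mul_smul_comm γ (d α β γ), ← smul_mul_assoc γ (omega α β γ lam), gamma_smul_omega hγ,
    mul_sub, ← mul_assoc, ← pow_two,
    d_sq_mul_u, hα, hβ]
  simp only [sub_mul, mul_smul_comm, smul_mul_assoc, pow_two, mul_assoc]
  module

end Relations

/-! ### Algebras with a basis of ordered monomials -/

/-- The elements `v` and `e` generate `A` and, together with `w`, satisfy the commutation relations
of a down-up algebra, in such a way that the monomials `wⁱ vʲ eˡ` are linearly independent. -/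
structure IsDownUpTriple {A : Type*} [Ring A] [Algebra k A] (lam mu γ : k) (v w e : A) : Prop where
  comm_w_v : w * v = mu • (v * w) + v
  comm_e_w : e * w = mu • (w * e) + e
  comm_e_v : e * v = lam • (v * e) + γ • w
  adjoin_eq_top : Algebra.adjoin k {v, e} = ⊤
  eq_zero_of_sum : ∀ {s : Finset ℕ} {c : ℕ → k[X][X]},
    ∑ i ∈ s, (c i).eval₂ (aeval w : k[X] →ₐ[k] A).toRingHom v * e ^ i = 0 → ∀ i ∈ s, c i = 0
  eq_zero_of_sum_w_pow : ∀ {s : Finset ℕ} {c : ℕ → k[X]},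
    ∑ i ∈ s, w ^ i * aeval v (c i) = 0 → ∀ i ∈ s, c i = 0

section Triple

variable {A : Type*} [Ring A] [Algebra k A]

/-- The subalgebra generated by two elements. -/
abbrev pairAlgebra (k : Type*) [Field k] {A : Type*} [Ring A] [Algebra k A] (v w : A) :
    Subalgebra k A :=
  Algebra.adjoin k {v, w}

/-- The first generator of `pairAlgebra`. -/
def pairFst (k : Type*) [Field k] {A : Type*} [Ring A] [Algebra k A] (v w : A) :
    pairAlgebra k v w :=
  ⟨v, Algebra.subset_adjoin (by simp)⟩

/-- The second generator of `pairAlgebra`. -/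
def pairSnd (k : Type*) [Field k] {A : Type*} [Ring A] [Algebra k A] (v w : A) :
    pairAlgebra k v w :=
  ⟨w, Algebra.subset_adjoin (by simp)⟩

/-- The evaluation of polynomials at the second generator of `pairAlgebra`. -/
noncomputable def polySnd (k : Type*) [Field k] {A : Type*} [Ring A] [Algebra k A] (v w : A) :
    k[X] →+* pairAlgebra k v w :=
  (aeval (pairSnd k v w) : k[X] →ₐ[k] pairAlgebra k v w).toRingHom

variable {v w e : A}

theorem polySnd_apply (f : k[X]) : polySnd k v w f = aeval (pairSnd k v w) f := rfl

theorem polySnd_C (c : k) : polySnd k v w (C c) = algebraMap k _ c := by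
  rw [polySnd_apply, aeval_C]

theorem adjoin_pairFst_pairSnd : Algebra.adjoin k {pairFst k v w, pairSnd k v w} = ⊤ := by
  refine Eq.trans ?_ (Algebra.adjoin_adjoin_coe_preimage (R := k) (s := {v, w}))
  congr 1
  ext x
  simp only [Set.mem_insert_iff, Set.mem_singleton_iff, Subtype.ext_iff]
  rfl

theorem coe_eval₂_polySnd (p : k[X][X]) :
    ((p.eval₂ (polySnd k v w) (pairFst k v w) : pairAlgebra k v w) : A) =
      p.eval₂ (aeval w : k[X] →ₐ[k] A).toRingHom v := by
  refine (hom_eval₂ p (polySnd k v w) (pairAlgebra k v w).val.toRingHom (pairFst k v w)).trans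
    (congrArg (fun f => eval₂ f v p) ?_)
  ext f
  · simp [polySnd]
  · simp [polySnd, pairSnd]

namespace IsDownUpTriple

variable (h : IsDownUpTriple lam mu γ v w e)
include h

theorem comm_pairSnd_pairFst : pairSnd k v w * pairFst k v w =
    mu • (pairFst k v w * pairSnd k v w) + pairFst k v w :=
  Subtype.ext h.comm_w_v

/-- Viewed over `k[w]` with variable `v`, the algebra needs no derivation: `v f(w) = g(w) v`, where
`g` is `f` twisted by the inverse of `X ↦ μ X + 1`. -/
theorem isLeftOreExtension_pairAlgebra (hmu : mu ≠ 0) :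
    IsLeftOreExtension (polySnd k v w) (pairFst k v w) := by
  have hc : ∀ b : k[X], ∃ b' b'', pairFst k v w * polySnd k v w b =
      polySnd k v w b' * pairFst k v w + polySnd k v w b'' ∧ (b ≠ 0 → b' ≠ 0) := by
    intro b
    refine ⟨(baseAut hmu).symm b, 0, ?_, by simp⟩
    rw [map_zero, add_zero, polySnd_apply, polySnd_apply,
      aeval_mul_eq_mul_aeval hmu h.comm_pairSnd_pairFst, AlgEquiv.apply_symm_apply]
  refine ⟨hc, fun p q hpq => ?_, eval₂_surjective_of_adjoin_eq_top (k := k) hc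
    (fun c => ⟨C c, polySnd_C c⟩) ?_ adjoin_pairFst_pairSnd⟩
  · rw [← sub_eq_zero]
    refine h.eq_zero_of_sum (s := {0}) (c := fun _ => p - q) ?_ 0 (by simp)
    have : (p - q).eval₂ (polySnd k v w) (pairFst k v w) = 0 := by
      rw [eval₂_sub, sub_eq_zero]
      exact hpq
    rw [Finset.sum_singleton, ← coe_eval₂_polySnd, this, ZeroMemClass.coe_zero, zero_mul]
  · rintro y (rfl | rfl)
    · exact .inr rfl
    · exact .inl ⟨X, by rw [polySnd_apply, aeval_X]⟩

variable (hlam : lam ≠ 0) (hmu : mu ≠ 0)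

/-- Passing `e` to the right twists by `v ↦ λ v`, `w ↦ μ w + 1`. The parameter `0` in `bivariateAut`
is deliberate: the term `γ w` of `e v` goes into the remainder `b`. -/
theorem exists_mul_eval₂ (p : k[X][X]) : ∃ b : pairAlgebra k v w,
    e * (p.eval₂ (polySnd k v w) (pairFst k v w) : pairAlgebra k v w) =
      ((bivariateAut hlam hmu 0 p).eval₂ (polySnd k v w) (pairFst k v w) :
        pairAlgebra k v w) * e + b := by
  induction p using Polynomial.induction_on with
  | C f =>
    refine ⟨0, ?_⟩
    rw [bivariateAut_C, coe_eval₂_polySnd, coe_eval₂_polySnd, eval₂_C, eval₂_C,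
      ZeroMemClass.coe_zero, add_zero]
    exact mul_aeval_eq_aeval_mul hmu h.comm_e_w f
  | add p q hp hq =>
    obtain ⟨b, hb⟩ := hp
    obtain ⟨b', hb'⟩ := hq
    refine ⟨b + b', ?_⟩
    rw [map_add, eval₂_add, eval₂_add]
    push_cast
    rw [mul_add, hb, hb', add_mul]
    abel
  | monomial n f ih =>
    obtain ⟨b, hb⟩ := ih
    rw [pow_succ, ← mul_assoc]
    generalize (C f * X ^ n : k[X][X]) = p at hb ⊢
    have h1 : bivariateAut hlam hmu 0 (p * X) =
        (C lam : k[X]) • (bivariateAut hlam hmu 0 p * X) := by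
      rw [map_mul, bivariateAut_X, zero_smul, add_zero, mul_smul_comm, smul_eq_C_mul,
        Algebra.smul_def]
      rfl
    refine ⟨γ • ((bivariateAut hlam hmu 0 p).eval₂ (polySnd k v w) (pairFst k v w) *
      pairSnd k v w) + b * pairFst k v w, ?_⟩
    rw [h1, eval₂_smul, polySnd_C, ← Algebra.smul_def, eval₂_mul_X, eval₂_mul_X]
    push_cast
    have hu : (pairFst k v w : A) = v := rfl
    have hω : (pairSnd k v w : A) = w := rfl
    rw [hu, hω, ← mul_assoc, hb, add_mul, mul_assoc, h.comm_e_v, mul_add,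
      mul_smul_comm, mul_smul_comm, smul_mul_assoc, mul_assoc]
    abel

include hlam hmu

theorem isLeftOreExtension : IsLeftOreExtension (pairAlgebra k v w).val.toRingHom e := by
  have hT := h.isLeftOreExtension_pairAlgebra hmu
  have hc : ∀ b : pairAlgebra k v w, ∃ b' b'' : pairAlgebra k v w,
      e * (pairAlgebra k v w).val.toRingHom b = (pairAlgebra k v w).val.toRingHom b' * e +
        (pairAlgebra k v w).val.toRingHom b'' ∧ (b ≠ 0 → b' ≠ 0) := by
    intro b
    obtain ⟨p, rfl⟩ := hT.bijective.2 b
    obtain ⟨b'', hb⟩ := h.exists_mul_eval₂ hlam hmu p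
    refine ⟨_, b'', hb, fun hp h0 => hp ?_⟩
    have : bivariateAut hlam hmu 0 p = 0 := hT.bijective.1 (by simpa using h0)
    rw [map_eq_zero_iff _ (AlgEquiv.injective _)] at this
    simp [this]
  refine ⟨hc, fun p q hpq => ?_, eval₂_surjective_of_adjoin_eq_top (k := k) hc
    (fun c => ⟨algebraMap k _ c, rfl⟩) ?_ h.adjoin_eq_top⟩
  · rw [← sub_eq_zero]
    have h0 : (p - q).eval₂ (pairAlgebra k v w).val.toRingHom e = 0 := by
      rw [eval₂_sub, sub_eq_zero]
      exact hpq
    choose c hc' using fun i => hT.bijective.2 ((p - q).coeff i)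
    simp only at hc'
    have h1 := h.eq_zero_of_sum (s := (p - q).support) (c := c) (by
      rw [← h0, eval₂_eq_sum, Polynomial.sum]
      refine Finset.sum_congr rfl fun i _ => ?_
      rw [← coe_eval₂_polySnd, hc']
      rfl)
    ext1 i
    rw [coeff_zero, ← hc']
    by_cases hi : i ∈ (p - q).support
    · rw [h1 i hi, eval₂_zero]
    · rw [hc', notMem_support_iff.1 hi]
  · rintro y (rfl | rfl)
    · exact .inl ⟨pairFst k y w, rfl⟩
    · exact .inr rfl

theorem exists_basis_pow :
    ∃ B : Module.Basis ℕ (pairAlgebra k v w) A, ∀ n, B n = e ^ n := by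
  have hA := h.isLeftOreExtension hlam hmu
  have hli : LinearIndependent (pairAlgebra k v w) fun n => e ^ n := by
    rw [linearIndependent_iff']
    intro s g hg i hi
    have : ∑ j ∈ s, monomial j (g j) = 0 := by
      refine hA.bijective.1 ?_
      simp only [eval₂_finsetSum, eval₂_monomial, eval₂_zero]
      exact hg
    have := congrArg (fun p => coeff p i) this
    simpa [finsetSum_coeff, coeff_monomial, hi] using this
  have hsp : ⊤ ≤ Submodule.span (pairAlgebra k v w) (Set.range fun n => e ^ n) := by
    rintro y -
    obtain ⟨p, rfl⟩ := hA.bijective.2 y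
    simp only [eval₂_eq_sum, Polynomial.sum]
    exact Submodule.sum_mem _ fun i _ =>
      Submodule.smul_mem _ (p.coeff i) (Submodule.subset_span ⟨i, rfl⟩)
  exact ⟨.mk hli hsp, fun n => Module.Basis.mk_apply hli hsp n⟩

end IsDownUpTriple

end Triple

end DownUpAlgebra

namespace DownUpAlgebra

variable {k : Type*} [Field k] {α β γ lam mu : k}

/-! ### The derivation of `k[X]` -/

/-- The automorphism `X ↦ c X` of `k[X]`. -/
noncomputable def scaleAut {c : k} (hc : c ≠ 0) : k[X] ≃ₐ[k] k[X] :=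
  letI := invertibleOfNonzero hc
  algEquivCMulXAddC c 0

theorem scaleAut_X {c : k} (hc : c ≠ 0) : scaleAut hc X = C c * X := by
  simp [scaleAut]

/-- The homomorphism to upper triangular matrices that combines the identity, the automorphism
`X ↦ c X` and the derivation `X ↦ - c X`. -/
noncomputable def triangularHom (c : k) : k[X] →ₐ[k] Matrix (Fin 2) (Fin 2) k[X] :=
  aeval !![X, -(C c * X); 0, C c * X]

theorem triangularHom_apply {c : k} (hc : c ≠ 0) (p : k[X]) :
    triangularHom c p 0 0 = p ∧ triangularHom c p 1 0 = 0 ∧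
      triangularHom c p 1 1 = scaleAut hc p := by
  induction p using Polynomial.induction_on with
  | C a =>
    rw [show scaleAut hc (C a) = C a from (scaleAut hc).commutes a]
    simp [triangularHom, Matrix.algebraMap_matrix_apply]
  | add p q hp hq =>
    rw [map_add, map_add]
    simp only [Matrix.add_apply, hp, hq, add_zero, and_self]
  | monomial n a ih =>
    rw [pow_succ, ← mul_assoc, map_mul (triangularHom c) (C a * X ^ n), map_mul (scaleAut hc),
      scaleAut_X]
    have hX : triangularHom c X = !![X, -(C c * X); 0, C c * X] := aeval_X _
    generalize (C a * X ^ n : k[X]) = p at ih ⊢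
    simp [Matrix.mul_apply, Fin.sum_univ_two, ih, hX]

/-- The `k`-linear map `δ` on `k[X]` with `δ(X) = - c X` that is a skew derivation for `X ↦ c X`. -/
noncomputable def skewDerivation (c : k) : k[X] →ₗ[k] k[X] where
  toFun p := triangularHom c p 0 1
  map_add' p q := by rw [map_add, Matrix.add_apply]
  map_smul' a p := by rw [map_smul, Matrix.smul_apply, RingHom.id_apply]

theorem skewDerivation_X (c : k) : skewDerivation c X = -(C c * X) := by
  simp [skewDerivation, triangularHom]

theorem skewDerivation_C (c a : k) : skewDerivation c (C a) = 0 := by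
  simp [skewDerivation, triangularHom, Matrix.algebraMap_matrix_apply]

/-- This is the upper right entry of a product of the matrices with rows `(p, δ p)` and `(0, σ p)`.
-/
theorem skewDerivation_mul {c : k} (hc : c ≠ 0) (p q : k[X]) :
    skewDerivation c (p * q) =
      skewDerivation c p * scaleAut hc q + p * skewDerivation c q := by
  change triangularHom c (p * q) 0 1 =
    triangularHom c p 0 1 * scaleAut hc q + p * triangularHom c q 0 1
  rw [map_mul, Matrix.mul_apply, Fin.sum_univ_two, (triangularHom_apply hc p).1,
    (triangularHom_apply hc q).2.2, add_comm]

section Pair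

variable {S : Type*} [Ring S] [Algebra k S] {v w : S}

theorem aeval_mul_eq_mul_scaleAut_add (hmu : mu ≠ 0) (h : w * v = mu • (v * w) + v) (p : k[X]) :
    aeval v p * w = w * aeval v (scaleAut (inv_ne_zero hmu) p) +
      aeval v (skewDerivation mu⁻¹ p) := by
  induction p using Polynomial.induction_on with
  | C a =>
    rw [show scaleAut _ (C a) = C a from (scaleAut (inv_ne_zero hmu)).commutes a,
      skewDerivation_C, map_zero, add_zero, aeval_C, Algebra.commutes]
  | add p q hp hq =>
    simp only [map_add, add_mul, mul_add, hp, hq]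
    abel
  | monomial n a ih =>
    rw [pow_succ, ← mul_assoc]
    generalize (C a * X ^ n : k[X]) = p at ih ⊢
    have h' : v * w = w * (mu⁻¹ • v) - mu⁻¹ • v := by
      rw [mul_smul_comm, h, smul_add, smul_smul, inv_mul_cancel₀ hmu, one_smul]
      abel
    have hX : aeval v (C mu⁻¹ * X) = mu⁻¹ • v := by
      rw [map_mul, aeval_C, aeval_X, ← Algebra.smul_def]
    rw [skewDerivation_mul (inv_ne_zero hmu), map_mul (scaleAut _), scaleAut_X, skewDerivation_X,
      map_add, mul_neg, map_neg, map_mul _ p X, map_mul _ (scaleAut _ p),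
      map_mul _ (skewDerivation _ p), map_mul _ p, hX, aeval_X, mul_assoc, h', mul_sub, ← mul_assoc, ih, add_mul, mul_assoc]
    abel

end Pair

section Triple

variable {A : Type*} [Ring A] [Algebra k A] {v w : A}

theorem genA_pair_eq_eval₂ : genA mu (pairFst k v w) (pairSnd k v w) =
    (C X + C (X + C mu⁻¹) * X : k[X][X]).eval₂ (polySnd k v w) (pairFst k v w) := by
  rw [eval₂_add, eval₂_mul_X, eval₂_C, eval₂_C, map_add, polySnd_C, polySnd_apply, aeval_X, genA]
  noncomm_ring

theorem genB_pair_eq_polySnd : genB mu (pairSnd k v w) =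
    polySnd k v w (X ^ 2 + C mu⁻¹ * X) := by
  rw [genB, polySnd_apply, map_add, map_mul, map_pow, aeval_X, aeval_C, Algebra.smul_def]

end Triple

/-- Extending a right ideal with two generators to a larger ring. -/
theorem span_image_rightIdealPair {A : Type*} [Ring A] [Algebra k A] {B : Subalgebra k A}
    (a b : B) : Submodule.span Aᵐᵒᵖ ((fun f : B => (f : A)) '' (rightIdealPair a b : RightIdeal B)) =
      rightIdealPair (a : A) (b : A) := by
  refine le_antisymm (Submodule.span_le.2 ?_) (Submodule.span_le.2 ?_)
  · rintro _ ⟨y, hy, rfl⟩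
    obtain ⟨s, t, rfl⟩ := mem_rightIdealPair.1 hy
    exact mem_rightIdealPair.2 ⟨s, t, by simp⟩
  · rintro _ (rfl | rfl)
    · exact Submodule.subset_span ⟨a, Submodule.subset_span (by simp), rfl⟩
    · exact Submodule.subset_span ⟨b, Submodule.subset_span (by simp), rfl⟩

namespace IsDownUpTriple

variable {A : Type*} [Ring A] [Algebra k A] {v w e : A} (h : IsDownUpTriple lam mu γ v w e)
include h

theorem isOreExtension (hmu : mu ≠ 0) :
    IsOreExtension (aeval (pairFst k v w) : k[X] →ₐ[k] pairAlgebra k v w).toRingHom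
      (pairSnd k v w) (scaleAut (inv_ne_zero hmu)).toRingEquiv
      (skewDerivation mu⁻¹).toAddMonoidHom := by
  refine ⟨skewDerivation_mul _, aeval_mul_eq_mul_scaleAut_add hmu h.comm_pairSnd_pairFst,
    fun s => existsUnique_of_exists_of_unique ?_ fun c c' hc hc' => ?_⟩
  · have hadd : ∀ y z : pairAlgebra k v w,
        (∃ c : ℕ →₀ k[X], y = c.sum fun n p => pairSnd k v w ^ n * aeval (pairFst k v w) p) →
        (∃ c : ℕ →₀ k[X], z = c.sum fun n p => pairSnd k v w ^ n * aeval (pairFst k v w) p) →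
        ∃ c : ℕ →₀ k[X], y + z = c.sum fun n p => pairSnd k v w ^ n * aeval (pairFst k v w) p := by
      rintro _ _ ⟨c, rfl⟩ ⟨c', rfl⟩
      exact ⟨c + c', by rw [Finsupp.sum_add_index'] <;> simp [mul_add]⟩
    obtain ⟨p, rfl⟩ := (h.isLeftOreExtension_pairAlgebra hmu).bijective.2 s
    induction p using Polynomial.induction_on' with
    | add p q hp hq =>
      simp only [eval₂_add]
      exact hadd _ _ hp hq
    | monomial i f =>
      simp only [eval₂_monomial, polySnd_apply]
      induction f using Polynomial.induction_on' with
      | add f g hf hg =>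
        rw [map_add, add_mul]
        exact hadd _ _ hf hg
      | monomial j a =>
        -- Scalars are central, so a monomial `a wʲ vⁱ` of the left normal form is already one of
        -- the right normal form.
        refine ⟨Finsupp.single j (monomial i a), ?_⟩
        rw [Finsupp.sum_single_index (by simp), aeval_monomial, Algebra.commutes a (pairSnd k v w ^ j),
          mul_assoc]
        congr 1
        exact (aeval_monomial (pairFst k v w)).symm
  · rw [← sub_eq_zero]
    have h0 : ((c - c').sum fun n p => w ^ n * aeval v p) = 0 := by
      rw [Finsupp.sum_sub_index (by simp [mul_sub]), sub_eq_zero]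
      have := congrArg (pairAlgebra k v w).val (hc.symm.trans hc')
      simp only [Finsupp.sum, map_sum, map_mul, map_pow] at this
      have hp : ∀ p : k[X], (pairAlgebra k v w).val (aeval (pairFst k v w) p) = aeval v p :=
        fun p => (aeval_algHom_apply (pairAlgebra k v w).val (pairFst k v w) p).symm
      have hw : (pairAlgebra k v w).val (pairSnd k v w) = w := rfl
      change ∑ a ∈ c.support, (pairAlgebra k v w).val (pairSnd k v w) ^ a *
          (pairAlgebra k v w).val (aeval (pairFst k v w) (c a)) =
        ∑ a ∈ c'.support, (pairAlgebra k v w).val (pairSnd k v w) ^ a *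
          (pairAlgebra k v w).val (aeval (pairFst k v w) (c' a)) at this
      simpa only [hp, hw, Finsupp.sum] using this
    have h1 := h.eq_zero_of_sum_w_pow h0
    ext1 n
    by_cases hn : n ∈ (c - c').support
    · exact h1 n hn
    · exact Finsupp.notMem_support_iff.1 hn

/-! ### Stable freeness and failure of principality -/

theorem pairSnd_ne_zero (hmu : mu ≠ 0) : pairSnd k v w ≠ 0 := by
  intro h0
  have hT := h.isLeftOreExtension_pairAlgebra hmu
  have := hT.bijective.1 (a₁ := C X) (a₂ := 0) (by simpa [polySnd_apply] using h0)
  simp at this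

/-- The generators have no common left factor but units, and generate a proper right ideal. -/
theorem rightIdealPair_ne_span_singleton (hlam : lam ≠ 0) (hmu : mu ≠ 0) (c : A) :
    rightIdealPair (genA mu v w) (genB mu w) ≠ Submodule.span Aᵐᵒᵖ {c} := by
  intro hc
  have hT := h.isLeftOreExtension_pairAlgebra hmu
  have hA := h.isLeftOreExtension hlam hmu
  have : NoZeroDivisors (pairAlgebra k v w) := hT.noZeroDivisors
  have hfac : ∀ {y}, y ∈ rightIdealPair (genA mu v w) (genB mu w) → ∃ s, c * s = y := by
    intro y hy
    rw [hc] at hy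
    obtain ⟨s, hs⟩ := Submodule.mem_span_singleton.1 hy
    exact ⟨s.unop, hs⟩
  obtain ⟨s, hs⟩ := hfac (y := genB mu w) (Submodule.subset_span (by simp))
  obtain ⟨t, ht⟩ := hfac (y := genA mu v w) (Submodule.subset_span (by simp))
  have ha : genA mu v w =
      (pairAlgebra k v w).val.toRingHom (genA mu (pairFst k v w) (pairSnd k v w)) :=
    (map_genA (v := pairFst k v w) (w := pairSnd k v w) (pairAlgebra k v w).val).symm
  have hb : genB mu w = (pairAlgebra k v w).val.toRingHom (genB mu (pairSnd k v w)) :=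
    (map_genB (w := pairSnd k v w) (pairAlgebra k v w).val).symm
  have hval : Function.Injective (pairAlgebra k v w).val.toRingHom := Subtype.val_injective
  have hB0 : (X ^ 2 + C mu⁻¹ * X : k[X]) ≠ 0 := by
    intro h0
    simpa [coeff_X] using congrArg (coeff · 2) h0
  have ha0 : genA mu (pairFst k v w) (pairSnd k v w) ≠ 0 := by
    rw [genA_pair_eq_eval₂]
    intro h0
    have h1 := hT.bijective.1 (a₁ := C X + C (X + C mu⁻¹) * X) (a₂ := 0) (by simpa using h0)
    have h2 := congrArg (coeff · 0) h1
    simp at h2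
  have hb0 : genB mu (pairSnd k v w) ≠ 0 := by
    rw [genB_pair_eq_polySnd]
    intro h0
    have := hT.bijective.1 (a₁ := C (X ^ 2 + C mu⁻¹ * X)) (a₂ := 0)
      (by simpa only [eval₂_C, eval₂_zero] using h0)
    exact hB0 (C_eq_zero.1 this)
  rw [hb] at hs
  rw [ha] at ht
  -- Degree in `e`: the factors of a nonzero element of the subalgebra lie in the subalgebra.
  obtain ⟨⟨c, rfl⟩, ⟨s, rfl⟩⟩ := hA.mem_range_of_mul_eq hb0 hs
  obtain ⟨-, ⟨t, rfl⟩⟩ := hA.mem_range_of_mul_eq ha0 ht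
  rw [← map_mul] at hs ht
  have hs := hval hs
  have ht := hval ht
  rw [genB_pair_eq_polySnd] at hs
  -- Degree in `v`: a factor of `b`, a nonzero polynomial in `w`, is itself a polynomial in `w`.
  obtain ⟨⟨f, rfl⟩, -⟩ := hT.mem_range_of_mul_eq hB0 hs
  obtain ⟨q, rfl⟩ := hT.bijective.2 t
  rw [genA_pair_eq_eval₂] at ht
  have hq : C f * q = C X + C (X + C mu⁻¹) * X :=
    hT.bijective.1 (by simpa only [← smul_eq_C_mul f, eval₂_smul] using ht)
  have hq0 : f * q.coeff 0 = X := by simpa using congrArg (coeff · 0) hq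
  have hq1 : f * q.coeff 1 = X + C mu⁻¹ := by
    simpa [coeff_C_succ] using congrArg (coeff · 1) hq
  -- `f` divides `X` and `X + μ⁻¹`, whose difference is a unit.
  have hf : f * ((q.coeff 1 - q.coeff 0) * C mu) = 1 := by
    rw [← mul_assoc, mul_sub, hq0, hq1, add_sub_cancel_left, ← C_mul, inv_mul_cancel₀ hmu, C_1]
  have h1 : (1 : A) ∈ rightIdealPair (genA mu v w) (genB mu w) := by
    rw [hc]
    refine Submodule.mem_span_singleton.2
      ⟨.op ((pairAlgebra k v w).val.toRingHom (polySnd k v w ((q.coeff 1 - q.coeff 0) * C mu))), ?_⟩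
    change (pairAlgebra k v w).val.toRingHom (polySnd k v w f) * _ = 1
    rw [MulOpposite.unop_op, ← map_mul, ← map_mul, hf, map_one, map_one]
  rw [← rightColon_eq_rightIdealPair_genA_genB hmu h.comm_w_v] at h1
  obtain ⟨g, hg⟩ := h1
  have hv : (1 + v) * 1 = (pairAlgebra k v w).val.toRingHom (1 + pairFst k v w) := by
    rw [mul_one]
    rfl
  have hv' : 1 + pairFst k v w = (1 + X : k[X][X]).eval₂ (polySnd k v w) (pairFst k v w) := by
    simp
  have hv0 : 1 + pairFst k v w ≠ 0 := by
    rw [hv']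
    intro h0
    have h1 := hT.bijective.1 (a₁ := 1 + X) (a₂ := 0) (by simpa using h0)
    simpa using congrArg (coeff · 0) h1
  rw [hv] at hg
  obtain ⟨-, ⟨g, rfl⟩⟩ := hA.mem_range_of_mul_eq hv0 hg.symm
  have hw : w = (pairAlgebra k v w).val.toRingHom (pairSnd k v w) := rfl
  have hg' : 1 + pairFst k v w = pairSnd k v w * g := hval (by rw [map_mul]; exact hg)
  obtain ⟨r, rfl⟩ := hT.bijective.2 g
  have hr : 1 + X = C X * r := by
    refine hT.bijective.1 ?_
    simp only [← hv', ← smul_eq_C_mul (X : k[X]), eval₂_smul, polySnd_apply, aeval_X]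
    exact hg'
  -- The constant coefficient in `v` would give `1 = X * r.coeff 0` in `k[X]`, which fails at `X =
  -- 0`.
  have := congrArg (fun p : k[X][X] => (p.coeff 0).coeff 0) hr
  simp at this

variable (hlam : lam ≠ 0) (hmu : mu ≠ 0)
include hmu

theorem rightColon_pair_eq :
    rightColon (1 + pairFst k v w) (pairSnd k v w) =
      rightIdealPair (genA mu (pairFst k v w) (pairSnd k v w)) (genB mu (pairSnd k v w)) :=
  rightColon_eq_rightIdealPair_genA_genB hmu h.comm_pairSnd_pairFst

theorem span_image_rightColon :
    Submodule.span Aᵐᵒᵖ ((fun f : pairAlgebra k v w => (f : A)) ''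
      (rightColon (1 + pairFst k v w) (pairSnd k v w) : RightIdeal (pairAlgebra k v w))) =
      rightIdealPair (genA mu v w) (genB mu w) := by
  rw [h.rightColon_pair_eq hmu, span_image_rightIdealPair]
  exact congrArg₂ rightIdealPair
    (map_genA (v := pairFst k v w) (w := pairSnd k v w) (pairAlgebra k v w).val)
    (map_genB (w := pairSnd k v w) (pairAlgebra k v w).val)

include hlam

theorem isNontrivialStablyFree (f : A →+* k) :
    IsNontrivialStablyFree (rightIdealPair (genA mu v w) (genB mu w)) := by
  have hT := h.isLeftOreExtension_pairAlgebra hmu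
  have hA := h.isLeftOreExtension hlam hmu
  have : NoZeroDivisors (pairAlgebra k v w) := hT.noZeroDivisors
  have : NoZeroDivisors A := hA.noZeroDivisors
  have hw : w ≠ 0 := fun h0 => h.pairSnd_ne_zero hmu (Subtype.ext h0)
  obtain ⟨E⟩ := exists_rightColon_prod_equiv (bezout_of_comm h.comm_w_v)
    fun g hg => (mul_eq_zero.1 hg).resolve_left hw
  rw [rightColon_eq_rightIdealPair_genA_genB hmu h.comm_w_v] at E
  obtain ⟨hfin, hst⟩ := finite_and_isStablyFree_of_prod_equiv E
  refine ⟨hfin, hst, fun hfree => ?_⟩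
  have : InvariantBasisNumber Aᵐᵒᵖ := invariantBasisNumber_of_ringHom f.op
  obtain ⟨c, hc⟩ := exists_eq_span_singleton_of_free E hfree
  exact h.rightIdealPair_ne_span_singleton hlam hmu c hc

theorem isNontrivialStablyFree_rightColon (f : A →+* k) :
    IsNontrivialStablyFree (rightColon (1 + pairFst k v w) (pairSnd k v w)) := by
  have hT := h.isLeftOreExtension_pairAlgebra hmu
  have : NoZeroDivisors (pairAlgebra k v w) := hT.noZeroDivisors
  obtain ⟨E⟩ := exists_rightColon_prod_equiv (bezout_of_comm h.comm_pairSnd_pairFst)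
    fun g hg => (mul_eq_zero.1 hg).resolve_left (h.pairSnd_ne_zero hmu)
  obtain ⟨hfin, hst⟩ := finite_and_isStablyFree_of_prod_equiv E
  refine ⟨hfin, hst, fun hfree => ?_⟩
  have : InvariantBasisNumber (pairAlgebra k v w)ᵐᵒᵖ :=
    invariantBasisNumber_of_ringHom (f.comp (pairAlgebra k v w).val.toRingHom).op
  obtain ⟨c, hc⟩ := exists_eq_span_singleton_of_free E hfree
  rw [h.rightColon_pair_eq hmu] at hc
  -- A single generator over the subalgebra also generates the extended right ideal of `A`.
  refine h.rightIdealPair_ne_span_singleton hlam hmu c (le_antisymm ?_ ?_)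
  · rw [rightIdealPair, Submodule.span_le]
    have hfac : ∀ y ∈ rightIdealPair (genA mu (pairFst k v w) (pairSnd k v w))
        (genB mu (pairSnd k v w)), (y : A) ∈ Submodule.span Aᵐᵒᵖ {(c : A)} := by
      intro y hy
      rw [hc] at hy
      obtain ⟨s, rfl⟩ := Submodule.mem_span_singleton.1 hy
      exact Submodule.mem_span_singleton.2 ⟨.op (s.unop : A), rfl⟩
    rintro _ (rfl | rfl)
    · have := hfac (genA mu (pairFst k v w) (pairSnd k v w)) (Submodule.subset_span (by simp))
      rwa [show ((genA mu (pairFst k v w) (pairSnd k v w) : pairAlgebra k v w) : A) = _ from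
        map_genA (v := pairFst k v w) (w := pairSnd k v w) (pairAlgebra k v w).val] at this
    · have := hfac (genB mu (pairSnd k v w)) (Submodule.subset_span (by simp))
      rwa [show ((genB mu (pairSnd k v w) : pairAlgebra k v w) : A) = _ from
        map_genB (w := pairSnd k v w) (pairAlgebra k v w).val] at this
  · rw [Submodule.span_le, Set.singleton_subset_iff]
    have hcm : c ∈ rightIdealPair (genA mu (pairFst k v w) (pairSnd k v w))
        (genB mu (pairSnd k v w)) := hc ▸ Submodule.mem_span_singleton_self c
    obtain ⟨s, t, hst⟩ := mem_rightIdealPair.1 hcm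
    refine mem_rightIdealPair.2 ⟨s, t, ?_⟩
    rw [hst, Subalgebra.coe_add, Subalgebra.coe_mul, Subalgebra.coe_mul]
    exact congrArg₂ (· + ·) (congrArg (· * (s : A))
      (map_genA (v := pairFst k v w) (w := pairSnd k v w) (pairAlgebra k v w).val))
      (congrArg (· * (t : A)) (map_genB (w := pairSnd k v w) (pairAlgebra k v w).val))

end IsDownUpTriple

end DownUpAlgebra

/-! ### Application to the down-up algebra -/

namespace DownUpAlgebra

variable {k : Type*} [Field k] {α β γ lam mu : k}

theorem isDownUpTriple (hlam : lam ≠ 0) (hmu : mu ≠ 0) (hα : α = lam + mu)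
    (hβ : β = -(lam * mu)) (hγ : γ ≠ 0) :
    IsDownUpTriple (A := DownUpAlgebra k α β γ) lam mu γ (u α β γ) (omega α β γ lam)
      (d α β γ) where
  comm_w_v := omega_mul_u hγ hα hβ
  comm_e_w := d_mul_omega hγ hα hβ
  comm_e_v := d_mul_u hγ
  adjoin_eq_top := adjoin_u_d
  eq_zero_of_sum := eq_zero_of_sum_eval₂_mul_d_pow hlam hmu hα hβ hγ
  eq_zero_of_sum_w_pow := eq_zero_of_sum_omega_pow_mul_aeval_u hlam hmu hα hβ hγ

theorem exists_ringHom (k : Type*) [Field k] (α β γ : k) :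
    Nonempty (DownUpAlgebra k α β γ →+* k) :=
  ⟨(lift (0 : k) 0 (by simp) (by simp) : DownUpAlgebra k α β γ →ₐ[k] k).toRingHom⟩

end DownUpAlgebra

theorem corollary3 {k : Type*} [Field k] [CharZero k] (α β γ lam mu : k)
    (hβ : β ≠ 0) (hγ : γ ≠ 0)
    (hroots : (X ^ 2 - C α * X - C β : k[X]) = (X - C lam) * (X - C mu)) :
    -- `aA + bA` is a non-free, stably free right ideal of `A`
    IsNontrivialStablyFree
      (rightIdealPair
        (DownUpAlgebra.genA mu (DownUpAlgebra.u α β γ) (DownUpAlgebra.omega α β γ lam))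
        (DownUpAlgebra.genB mu (DownUpAlgebra.omega α β γ lam))) ∧
    -- `Ã` is the Ore extension `k[u][ω; σ, δ]`
    (∃ (σ : k[X] ≃ₐ[k] k[X]) (δ : k[X] →ₗ[k] k[X]),
      σ X = C mu⁻¹ * X ∧ δ X = -(C mu⁻¹ * X) ∧
      IsOreExtension
        (aeval (DownUpAlgebra.uTilde α β γ lam) :
          k[X] →ₐ[k] DownUpAlgebra.tilde α β γ lam).toRingHom
        (DownUpAlgebra.omegaTilde α β γ lam) σ.toRingEquiv δ.toAddMonoidHom) ∧
    -- `A` is a free left `Ã`-module with basis the powers of `d`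
    (∃ B : Module.Basis ℕ (DownUpAlgebra.tilde α β γ lam) (DownUpAlgebra k α β γ),
      ∀ n, B n = DownUpAlgebra.d α β γ ^ n) ∧
    -- `K` is a non-free, stably free right ideal of `Ã`, and `K = aÃ + bÃ`
    IsNontrivialStablyFree (DownUpAlgebra.idealK α β γ lam) ∧
    DownUpAlgebra.idealK α β γ lam =
      rightIdealPair
        (DownUpAlgebra.genA mu (DownUpAlgebra.uTilde α β γ lam)
          (DownUpAlgebra.omegaTilde α β γ lam))
        (DownUpAlgebra.genB mu (DownUpAlgebra.omegaTilde α β γ lam)) ∧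
    -- `KA = aA + bA`
    DownUpAlgebra.idealKA α β γ lam =
      rightIdealPair
        (DownUpAlgebra.genA mu (DownUpAlgebra.u α β γ) (DownUpAlgebra.omega α β γ lam))
        (DownUpAlgebra.genB mu (DownUpAlgebra.omega α β γ lam)) := by
  have hα : α = lam + mu := by
    have h := congrArg (coeff · 1) hroots
    simp [coeff_X, coeff_C, sub_mul, mul_sub] at h
    linear_combination -h
  have hβ' : β = -(lam * mu) := by
    have h := congrArg (coeff · 0) hroots
    simp at h
    linear_combination -h
  have hlam : lam ≠ 0 := by
    rintro rfl
    simp [hβ'] at hβ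
  have hmu : mu ≠ 0 := by
    rintro rfl
    simp [hβ'] at hβ
  have h := DownUpAlgebra.isDownUpTriple hlam hmu hα hβ' hγ
  obtain ⟨f⟩ := DownUpAlgebra.exists_ringHom k α β γ
  refine ⟨h.isNontrivialStablyFree hlam hmu f, ⟨DownUpAlgebra.scaleAut (inv_ne_zero hmu),
    DownUpAlgebra.skewDerivation mu⁻¹, DownUpAlgebra.scaleAut_X _,
    DownUpAlgebra.skewDerivation_X _, h.isOreExtension hmu⟩, h.exists_basis_pow hlam hmu,
    h.isNontrivialStablyFree_rightColon hlam hmu f, h.rightColon_pair_eq hmu,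
    h.span_image_rightColon hmu⟩
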